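/- A \emph{tree} is an undirected, connected (non-empty), locally finite graph without cycles. Assigning a positive length to each edge of a tree induces the shortest path metric $d$ on its vertex set $T$, and the resulting metric space $(T,d)$ is called a \emph{metric tree}. The \emph{generalized roundness} $\wp_{(X,d)} \in [0,\infty]$ of a metric space $(X,d)$ is the supremum of all $p \ge 0$ such that, for all integers $k \ge 2$ and all (not necessarily distinct) points $a_1,\dots,a_k,b_1,\dots,b_k \in X$, $$\sum_{1 \le i<j \le k} \left( d(a_i,a_j)^p + d(b_i,b_j)^p \right) \le \sum_{1 \le i,j \le k} d(a_i,b_j)^p .$$ Let $\ell_2$ be the real Hilbert space of square summable sequences. Theorem. Let $(T,d)$ be a metric tree. If $\wp_{(T,d)} = 1$, then (1) $(T,\sqrt{d})$ is isometric to an affinely independent subset of $\ell_2$, and (2) for every $p$ with $1 < p \le 2$, $(T,\sqrt{d^p})$ does not embed isometrically into $\ell_2$; that is, there is no map $f : T \to \ell_2$ with $\|f(x)-f(y)\| = d(x,y)^{p/2}$ for all $x,y \in T$. Conversely, every metric tree $(T,d)$ that satisfies condition (2) has generalized roundness $\wp_{(T,d)} = 1$. -/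

import Mathlib

open scoped NNReal ENNReal

noncomputable section

namespace MetricTrees

/-- `p` is a generalized roundness exponent of `X`. The points of a simplex need not be distinct.
(At `p = 0` the real power has `0 ^ 0 = 1`; there the inequality always holds.) -/
def IsGeneralizedRoundnessExponent (X : Type*) [MetricSpace X] (p : ℝ≥0) : Prop :=
  ∀ k : ℕ, 2 ≤ k → ∀ a b : Fin k → X,
    ∑ i : Fin k, ∑ j ∈ Finset.Ioi i,
        (dist (a i) (a j) ^ (p : ℝ) + dist (b i) (b j) ^ (p : ℝ)) ≤
      ∑ i : Fin k, ∑ j : Fin k, dist (a i) (b j) ^ (p : ℝ)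

/-- The generalized roundness of `X`: the supremum, in `[0, ∞]`, of all its generalized roundness
exponents. -/
def generalizedRoundness (X : Type*) [MetricSpace X] : ℝ≥0∞ :=
  ⨆ (p : ℝ≥0) (_ : IsGeneralizedRoundnessExponent X p), (p : ℝ≥0∞)

/-- The total length of a walk in a graph whose edges `e` have lengths `ℓ e`. -/
def walkLength {V : Type*} {G : SimpleGraph V} (ℓ : Sym2 V → ℝ) {u v : V} (q : G.Walk u v) : ℝ :=
  (q.edges.map ℓ).sum

/-- A metric tree: the vertex set of a locally finite tree (connected, nonempty, without cycles)
whose edges carry positive lengths, with the shortest path metric. -/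
def IsMetricTree (T : Type*) [MetricSpace T] : Prop :=
  ∃ (G : SimpleGraph T) (ℓ : Sym2 T → ℝ),
    G.IsTree ∧ (∀ v, (G.neighborSet v).Finite) ∧ (∀ e ∈ G.edgeSet, 0 < ℓ e) ∧
      ∀ u v : T, IsLeast (Set.range fun q : G.Walk u v => walkLength ℓ q) (dist u v)

/-- The real Hilbert space of square summable sequences. -/
abbrev EllTwo : Type := lp (fun _ : ℕ => ℝ) 2

/-- `f` is an isometric embedding of the metric transform `(X, √(d ^ p))` into `ℓ₂`. -/
def IsPowerEmbedding {X : Type*} [MetricSpace X] (p : ℝ) (f : X → EllTwo) : Prop :=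
  ∀ x y : X, dist (f x) (f y) = √(dist x y ^ p)

/-- `(X, √d)` is isometric to an affinely independent subset of `ℓ₂`. -/
def SqrtIsometricToAffinelyIndependent (X : Type*) [MetricSpace X] : Prop :=
  ∃ S : Set EllTwo, AffineIndependent ℝ ((↑) : S → EllTwo) ∧
    ∃ e : X ≃ S, ∀ x y : X, dist (e x) (e y) = √(dist x y)

/-- `(X, √(d ^ p))` does not embed isometrically into `ℓ₂` for any `p` with `1 < p ≤ 2`. -/
def NoPowerEmbedding (X : Type*) [MetricSpace X] : Prop :=
  ∀ p : ℝ, 1 < p → p ≤ 2 → ¬ ∃ f : X → EllTwo, IsPowerEmbedding p f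

end MetricTrees

end

open scoped RealInnerProductSpace

namespace MetricTrees

/-! On a nonempty countable space, `p > 0` is a roundness exponent exactly when `√(d ^ p)` embeds in
`ℓ₂` (`IsPowerEmbedding.isGeneralizedRoundnessExponent`,
`IsGeneralizedRoundnessExponent.exists_isPowerEmbedding`). For a metric tree `p = 1` always works:
give the edges orthonormal directions and send a vertex to the sum of `√(ℓ e) • u e` along its path
from a root. Pythagoras gives the distances, and the image is affinely independent. So the roundness
is at least 1, and it equals 1 iff no exponent exceeds 1. Condition (2) only speaks of `p ≤ 2`. An
exponent above 2 forbids metric betweenness, so the tree has at most two vertices and `p = 2` embeds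
as well. -/

/-! ### Embeddings give roundness. -/

lemma sum_sum_eq_two_mul_sum_Ioi {k : ℕ} (D : Fin k → Fin k → ℝ) (hs : ∀ i j, D i j = D j i)
    (h0 : ∀ i, D i i = 0) :
    ∑ i, ∑ j, D i j = 2 * ∑ i, ∑ j ∈ Finset.Ioi i, D i j := by
  have h := Finset.sum_sum_Ioi_add_eq_sum_sum_off_diag (fun i j => D j i)
  have h2 : ∀ i, ∑ j, D i j = ∑ j ∈ {i}ᶜ, D i j := fun i => by
    rw [← Finset.sum_add_sum_compl {i}]; simp [h0]
  simp_rw [h2]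
  rw [← h, Finset.mul_sum]
  refine Finset.sum_congr rfl fun i _ => ?_
  rw [Finset.mul_sum]
  exact Finset.sum_congr rfl fun j _ => by rw [hs j i]; ring

/-- The roundness inequality, with the sums over pairs replaced by full double sums. -/
lemma isGeneralizedRoundnessExponent_iff {X : Type*} [MetricSpace X] {p : ℝ≥0} (hp : p ≠ 0) :
    IsGeneralizedRoundnessExponent X p ↔ ∀ (k : ℕ) (a b : Fin k → X),
      ∑ i, ∑ j, dist (a i) (a j) ^ (p : ℝ) + ∑ i, ∑ j, dist (b i) (b j) ^ (p : ℝ) ≤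
        2 * ∑ i, ∑ j, dist (a i) (b j) ^ (p : ℝ) := by
  have hp' : (p : ℝ) ≠ 0 := by exact_mod_cast hp
  have key : ∀ (k : ℕ) (a : Fin k → X), ∑ i, ∑ j, dist (a i) (a j) ^ (p : ℝ) =
      2 * ∑ i, ∑ j ∈ Finset.Ioi i, dist (a i) (a j) ^ (p : ℝ) := fun k a =>
    sum_sum_eq_two_mul_sum_Ioi _ (fun i j => by rw [dist_comm]) fun i => by
      simp [Real.zero_rpow hp']
  constructor
  · intro h k a b
    -- Simplices with fewer than two points satisfy the inequality automatically.
    obtain hk | hk := lt_or_ge k 2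
    · interval_cases k
      · simp
      · simp only [Fin.sum_univ_one, dist_self, Real.zero_rpow hp']
        simpa using Real.rpow_nonneg dist_nonneg _
    · have := h k hk a b
      simp only [Finset.sum_add_distrib] at this
      rw [key, key]
      linarith
  · intro h k _ a b
    have := h k a b
    rw [key, key] at this
    simp only [Finset.sum_add_distrib]
    linarith

lemma sum_sum_norm_sub_sq {E : Type*} [NormedAddCommGroup E] [InnerProductSpace ℝ E] {k : ℕ}
    (a b : Fin k → E) :
    ∑ i, ∑ j, ‖a i - b j‖ ^ 2 =
      k * ∑ i, ‖a i‖ ^ 2 + k * ∑ i, ‖b i‖ ^ 2 - 2 * ⟪∑ i, a i, ∑ i, b i⟫ := by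
  simp_rw [norm_sub_sq_real, Finset.sum_add_distrib, Finset.sum_sub_distrib, sum_inner, inner_sum]
  simp [Finset.mul_sum]
  ring

/-- An isometric embedding of `(X, √(d ^ p))` into `ℓ₂` makes `p` a roundness exponent. -/
lemma IsPowerEmbedding.isGeneralizedRoundnessExponent {X : Type*} [MetricSpace X] {p : ℝ≥0}
    (hp : p ≠ 0) {f : X → EllTwo} (hf : IsPowerEmbedding p f) :
    IsGeneralizedRoundnessExponent X p := by
  rw [isGeneralizedRoundnessExponent_iff hp]
  intro k a b
  have h : ∀ x y : X, dist x y ^ (p : ℝ) = ‖f x - f y‖ ^ 2 := fun x y => by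
    rw [← dist_eq_norm, hf, Real.sq_sqrt (by positivity)]
  simp_rw [h]
  rw [sum_sum_norm_sub_sq (fun i => f (a i)) fun j => f (a j),
    sum_sum_norm_sub_sq (fun i => f (b i)) fun j => f (b j),
    sum_sum_norm_sub_sq (fun i => f (a i)) fun j => f (b j)]
  -- The right side minus the left is `2 * ‖∑ f (a i) - ∑ f (b i)‖ ^ 2`.
  have := norm_sub_sq_real (∑ i, f (a i)) (∑ i, f (b i))
  have h2 := sq_nonneg ‖∑ i, f (a i) - ∑ i, f (b i)‖
  rw [real_inner_self_eq_norm_sq, real_inner_self_eq_norm_sq]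
  linarith

/-! ### Roundness gives positive semidefinite Gram kernels. -/

/-- Roundness exponents satisfy the negative type inequality with integer weights. -/
lemma IsGeneralizedRoundnessExponent.sum_int_mul_nonpos {X : Type*} [MetricSpace X] {p : ℝ≥0}
    (hp : p ≠ 0) (h : IsGeneralizedRoundnessExponent X p) {ι : Type*} [Fintype ι] (x : ι → X)
    (z : ι → ℤ) (hz : ∑ i, z i = 0) :
    ∑ i, ∑ j, (z i : ℝ) * z j * dist (x i) (x j) ^ (p : ℝ) ≤ 0 := by
  rw [isGeneralizedRoundnessExponent_iff hp] at h
  -- Repeat `x i` according to the positive part of `z i` in one family and to the negative part in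
  -- the other; since the weights sum to zero, both families have `k` points.
  let k := ∑ i, (z i).toNat
  have hk : ∑ i, (-z i).toNat = k := by
    have h2 : k = ∑ i, (z i).toNat := rfl
    zify at h2 ⊢
    rw [h2, ← sub_eq_zero, ← Finset.sum_sub_distrib, ← neg_eq_zero, ← Finset.sum_neg_distrib, ← hz]
    exact Finset.sum_congr rfl fun i _ => by omega
  have key : ∀ m : ι → ℕ, ∑ i, m i = k → ∃ t : Fin k → ι, ∀ g : ι → ℝ,
      ∑ i, g (t i) = ∑ i, m i * g i := by
    intro m hm
    let e : (Σ i, Fin (m i)) ≃ Fin k := Fintype.equivFinOfCardEq (by simp [hm])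
    refine ⟨fun i => (e.symm i).1, fun g => ?_⟩
    rw [Equiv.sum_comp e.symm (fun s => g s.1), Fintype.sum_sigma]
    simp
  obtain ⟨s, hs⟩ := key _ rfl
  obtain ⟨t, ht⟩ := key _ hk
  have double : ∀ {s t : Fin k → ι} {m n : ι → ℕ}, (∀ g : ι → ℝ, ∑ i, g (s i) = ∑ i, m i * g i) →
      (∀ g : ι → ℝ, ∑ i, g (t i) = ∑ i, n i * g i) →
      ∑ i, ∑ j, dist (x (s i)) (x (t j)) ^ (p : ℝ) =
        ∑ i, ∑ j, (m i : ℝ) * n j * dist (x i) (x j) ^ (p : ℝ) := by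
    intro s t m n hs ht
    calc _ = ∑ i, ∑ j, (n j : ℝ) * dist (x (s i)) (x j) ^ (p : ℝ) :=
          Finset.sum_congr rfl fun i _ => ht fun j => dist (x (s i)) (x j) ^ (p : ℝ)
      _ = _ := by
        rw [hs fun i => ∑ j, (n j : ℝ) * dist (x i) (x j) ^ (p : ℝ)]
        simp only [Finset.mul_sum, mul_assoc]
  have := h k (fun i => x (s i)) (fun i => x (t i))
  rw [double hs hs, double ht ht, two_mul] at this
  nth_rewrite 2 [double hs ht] at this
  have hswap : ∑ i, ∑ j, dist (x (s i)) (x (t j)) ^ (p : ℝ) =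
      ∑ i, ∑ j, ((-z i).toNat : ℝ) * (z j).toNat * dist (x i) (x j) ^ (p : ℝ) := by
    rw [Finset.sum_comm, ← double ht hs]
    simp only [dist_comm]
  rw [hswap] at this
  have hzi : ∀ i, (z i : ℝ) = (z i).toNat - (-z i).toNat := fun i => by
    have : z i = (z i).toNat - (-z i).toNat := by omega
    exact_mod_cast this
  refine le_trans (le_of_eq ?_) (sub_nonpos.2 this)
  simp only [← Finset.sum_add_distrib, ← Finset.sum_sub_distrib]
  refine Finset.sum_congr rfl fun i _ => Finset.sum_congr rfl fun j _ => ?_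
  rw [hzi i, hzi j]
  ring

/-- The Gram kernel of an embedding of `(X, √(d ^ p))` that sends `o` to the origin. -/
noncomputable def gramKernel {X : Type*} [MetricSpace X] (p : ℝ) (o x y : X) : ℝ :=
  (dist x o ^ p + dist y o ^ p - dist x y ^ p) / 2

lemma IsGeneralizedRoundnessExponent.gramKernel_int_nonneg {X : Type*} [MetricSpace X] {p : ℝ≥0}
    (hp : p ≠ 0) (h : IsGeneralizedRoundnessExponent X p) (o : X) {ι : Type*} [Fintype ι]
    (x : ι → X) (z : ι → ℤ) :
    0 ≤ ∑ i, ∑ j, (z i : ℝ) * z j * gramKernel p o (x i) (x j) := by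
  have hp' : (p : ℝ) ≠ 0 := by exact_mod_cast hp
  -- Adjoining the base point `o` with weight `-∑ z i` balances arbitrary weights.
  have := h.sum_int_mul_nonpos hp (ι := Option ι) (fun i => i.elim o x)
    (fun i => i.elim (-∑ i, z i) z) (by simp [Fintype.sum_option])
  simp only [Fintype.sum_option, Option.elim_none, Option.elim_some, dist_self,
    Real.zero_rpow hp', Finset.sum_add_distrib] at this
  have e1 : ∑ i, ∑ j, (z i : ℝ) * z j * gramKernel p o (x i) (x j) =
      (∑ i, ∑ j, (z i : ℝ) * z j * dist (x i) o ^ (p : ℝ) +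
        ∑ i, ∑ j, (z i : ℝ) * z j * dist (x j) o ^ (p : ℝ) -
        ∑ i, ∑ j, (z i : ℝ) * z j * dist (x i) (x j) ^ (p : ℝ)) / 2 := by
    simp only [gramKernel, ← Finset.sum_add_distrib, ← Finset.sum_sub_distrib, Finset.sum_div]
    exact Finset.sum_congr rfl fun i _ => Finset.sum_congr rfl fun j _ => by ring
  have e2 : ∑ i, (z i : ℝ) * ((-∑ j, z j : ℤ) : ℝ) * dist (x i) o ^ (p : ℝ) =
      -∑ i, ∑ j, (z i : ℝ) * z j * dist (x i) o ^ (p : ℝ) := by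
    push_cast
    simp only [← Finset.sum_neg_distrib, Finset.mul_sum, Finset.sum_mul]
    exact Finset.sum_congr rfl fun i _ => Finset.sum_congr rfl fun j _ => by ring
  have e3 : ∑ j, ((-∑ j, z j : ℤ) : ℝ) * (z j : ℝ) * dist o (x j) ^ (p : ℝ) =
      -∑ i, ∑ j, (z i : ℝ) * z j * dist (x j) o ^ (p : ℝ) := by
    rw [Finset.sum_comm]
    push_cast
    simp only [← Finset.sum_neg_distrib, Finset.sum_mul]
    exact Finset.sum_congr rfl fun i _ => Finset.sum_congr rfl fun j _ => by
      rw [dist_comm]; ring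
  rw [e1]
  rw [e2, e3] at this
  linarith

lemma tendsto_floor_mul_div (a : ℝ) :
    Filter.Tendsto (fun N : ℕ => (⌊(N : ℝ) * a⌋ : ℝ) / N) Filter.atTop (nhds a) := by
  have h : Filter.Tendsto (fun N : ℕ => a - (1 : ℝ) / N) Filter.atTop (nhds a) := by
    simpa using tendsto_const_nhds.sub (tendsto_const_div_atTop_nhds_zero_nat (1 : ℝ))
  refine tendsto_of_tendsto_of_tendsto_of_le_of_le' h tendsto_const_nhds ?_ ?_ <;>
    filter_upwards [Filter.eventually_gt_atTop 0] with N hN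
  · have hN' : (0 : ℝ) < N := by exact_mod_cast hN
    rw [le_div_iff₀ hN', sub_mul, div_mul_cancel₀ _ hN'.ne']
    linarith [Int.sub_one_lt_floor ((N : ℝ) * a)]
  · have hN' : (0 : ℝ) < N := by exact_mod_cast hN
    rw [div_le_iff₀ hN']
    linarith [Int.floor_le ((N : ℝ) * a)]

lemma IsGeneralizedRoundnessExponent.gramKernel_nonneg {X : Type*} [MetricSpace X] {p : ℝ≥0}
    (hp : p ≠ 0) (h : IsGeneralizedRoundnessExponent X p) (o : X) {ι : Type*} [Fintype ι]
    (x : ι → X) (w : ι → ℝ) :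
    0 ≤ ∑ i, ∑ j, w i * w j * gramKernel p o (x i) (x j) := by
  -- Real weights are limits of rational ones with common denominator `N`, and the form is
  -- homogeneous of degree two.
  have hlim : Filter.Tendsto (fun N : ℕ => ∑ i, ∑ j, ((⌊(N : ℝ) * w i⌋ : ℝ) / N) *
      ((⌊(N : ℝ) * w j⌋ : ℝ) / N) * gramKernel p o (x i) (x j)) Filter.atTop
      (nhds (∑ i, ∑ j, w i * w j * gramKernel p o (x i) (x j))) :=
    tendsto_finsetSum _ fun i _ => tendsto_finsetSum _ fun j _ =>
      ((tendsto_floor_mul_div _).mul (tendsto_floor_mul_div _)).mul_const _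
  refine ge_of_tendsto' hlim fun N => ?_
  have := h.gramKernel_int_nonneg hp o x (fun i => ⌊(N : ℝ) * w i⌋)
  have h2 := div_nonneg this (sq_nonneg (N : ℝ))
  refine h2.trans_eq ?_
  simp only [Finset.sum_div]
  exact Finset.sum_congr rfl fun i _ => Finset.sum_congr rfl fun j _ => by ring

/-! ### From kernels to vectors in `ℓ₂`. -/

/-- A Hilbert space with a countable Hilbert basis embeds linearly and isometrically in `ℓ₂`. -/
lemma exists_linearIsometry_ellTwo (E : Type*) [NormedAddCommGroup E] [InnerProductSpace ℝ E]
    [CompleteSpace E] [TopologicalSpace.SeparableSpace E] : Nonempty (E →ₗᵢ[ℝ] EllTwo) := by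
  obtain ⟨w, b, hb⟩ := exists_hilbertBasis ℝ E
  have : SecondCountableTopology E := UniformSpace.secondCountable_of_separable E
  -- Distinct orthonormal vectors are `√2` apart, so in a separable space there are only countably
  -- many.
  have hd : DiscreteTopology w := by
    refine DiscreteTopology.of_forall_le_dist zero_lt_one fun x y hxy => ?_
    have h1 := b.orthonormal.1 x
    have h2 := b.orthonormal.1 y
    have h3 := b.orthonormal.2 hxy
    have h4 := norm_sub_sq_real (b x) (b y)
    rw [h1, h2, h3] at h4
    have h5 : dist x y = ‖b x - b y‖ := by rw [Subtype.dist_eq, dist_eq_norm, hb]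
    change 1 ≤ dist x y
    rw [h5]
    nlinarith [norm_nonneg (b x - b y)]
  have hc : Countable w := TopologicalSpace.separableSpace_iff_countable.1 inferInstance
  obtain ⟨g, hg⟩ := exists_injective_nat w
  let c : HilbertBasis ℕ ℝ EllTwo := HilbertBasis.ofRepr (LinearIsometryEquiv.refl ℝ EllTwo)
  have ho : Orthonormal ℝ (fun i => c (g i)) := c.orthonormal.comp g hg
  exact ⟨ho.orthogonalFamily.linearIsometry.comp b.repr.toLinearIsometry⟩

/-- A positive semidefinite kernel on a countable set is the Gram kernel of vectors in `ℓ₂`. -/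
lemma exists_ellTwo_inner_eq {X : Type*} [Countable X] (K : X → X → ℝ)
    (hs : ∀ x y, K x y = K y x)
    (hK : ∀ w : X →₀ ℝ, 0 ≤ w.sum fun x a => w.sum fun y b => a * b * K x y) :
    ∃ f : X → EllTwo, ∀ x y, ⟪f x, f y⟫ = K x y := by
  let M : Matrix X X (ℝ →L[ℝ] ℝ) := .of fun x y => K x y • (1 : ℝ →L[ℝ] ℝ)
  have hM : M.PosSemidef := by
    have h := (RKHS.posSemidef_tfae (𝕜 := ℝ) (K := M)).out 0 2
    refine h.2 (And.intro ?_ fun w => ?_)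
    · ext x y
      simp [M, Matrix.conjTranspose_apply, hs x y]
    · refine (hK w).trans_eq ?_
      simp only [M, Matrix.of_apply, Finsupp.sum]
      refine Finset.sum_congr rfl fun x _ => Finset.sum_congr rfl fun y _ => ?_
      simp [hs x y]
      ring
  have : Fact M.PosSemidef := ⟨hM⟩
  let H := RKHS.OfKernel M
  -- Kernel functions form countably many separable ranges, and their span is dense.
  have hsep : TopologicalSpace.SeparableSpace H := by
    have h1 := RKHS.kerFun_dense (𝕜 := ℝ) (H := H) (X := X) (V := ℝ)
    have h2 : TopologicalSpace.IsSeparable {RKHS.kerFun H x v | (x : X) (v : ℝ)} := by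
      have : {RKHS.kerFun H x v | (x : X) (v : ℝ)} =
          ⋃ x : X, Set.range (RKHS.kerFun H x : ℝ → H) := by ext; simp
      rw [this]
      exact .iUnion fun x => TopologicalSpace.isSeparable_range (RKHS.kerFun H x).continuous
    have h3 := (h2.span (R := ℝ)).closure
    rw [← Submodule.topologicalClosure_coe, h1] at h3
    exact TopologicalSpace.isSeparable_univ_iff.1 h3
  obtain ⟨φ⟩ := exists_linearIsometry_ellTwo H
  refine ⟨fun x => φ (RKHS.kerFun H x (1 : ℝ)), fun x y => ?_⟩
  rw [φ.inner_map_map, ← RKHS.kernel_inner, RKHS.OfKernel.kernel_ofKernel, hs]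
  simp [M]

/-- Schoenberg: a roundness exponent gives an embedding of `(X, √(d ^ p))`. -/
lemma IsGeneralizedRoundnessExponent.exists_isPowerEmbedding {X : Type*} [MetricSpace X]
    [Countable X] [Nonempty X] {p : ℝ≥0} (hp : p ≠ 0) (h : IsGeneralizedRoundnessExponent X p) :
    ∃ f : X → EllTwo, IsPowerEmbedding p f := by
  have hp' : (p : ℝ) ≠ 0 := by exact_mod_cast hp
  obtain ⟨o⟩ := ‹Nonempty X›
  obtain ⟨f, hf⟩ := exists_ellTwo_inner_eq (gramKernel (p : ℝ) o)
    (fun x y => by simp only [gramKernel, dist_comm x y]; ring) fun w => by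
      have := h.gramKernel_nonneg hp o (fun i : w.support => i.1) (fun i => w i.1)
      simp only [Finsupp.sum]
      rw [← Finset.sum_coe_sort]
      simpa only [← Finset.sum_coe_sort w.support] using this
  refine ⟨f, fun x y => ?_⟩
  rw [dist_eq_norm, eq_comm, Real.sqrt_eq_iff_mul_self_eq (by positivity) (norm_nonneg _), ← sq,
    norm_sub_sq_real, ← real_inner_self_eq_norm_sq, ← real_inner_self_eq_norm_sq, hf, hf, hf]
  simp only [gramKernel, dist_self, Real.zero_rpow hp']
  ring

/-! ### Trees and their canonical map. -/

section Graph

variable {V : Type*} {G : SimpleGraph V}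

/-- Induction on the length of a walk to a fixed root. Countability lets the edges index an
orthonormal family in `ℓ₂` and makes the kernel space separable. -/
lemma countable_of_locallyFinite (hG : G.Connected) (hfin : ∀ v, (G.neighborSet v).Finite) :
    Countable V := by
  obtain ⟨r⟩ := hG.nonempty
  have h : ∀ n : ℕ, {v | ∃ q : G.Walk v r, q.length = n}.Countable := by
    intro n
    induction n with
    | zero =>
      refine (Set.countable_singleton r).mono ?_
      rintro v ⟨q, hq⟩
      exact SimpleGraph.Walk.eq_of_length_eq_zero hq
    | succ n ih =>
      refine (ih.biUnion fun v _ => (hfin v).countable).mono ?_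
      rintro v ⟨q, hq⟩
      cases q with
      | nil => simp at hq
      | cons hadj q =>
        simp only [SimpleGraph.Walk.length_cons, Nat.add_right_cancel_iff] at hq
        exact Set.mem_biUnion ⟨q, hq⟩ hadj.symm
  refine Set.countable_univ_iff.1 ((Set.countable_iUnion h).mono fun v _ => ?_)
  obtain ⟨q⟩ := hG.preconnected v r
  exact Set.mem_iUnion.2 ⟨q.length, q, rfl⟩

/-- Removing the detours of `w` leaves the unique path `q`, so `w` uses every edge of `q`. -/
lemma walkLength_le_of_isPath [DecidableEq V] {ℓ : Sym2 V → ℝ} (hG : G.IsTree)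
    (hℓ : ∀ e ∈ G.edgeSet, 0 < ℓ e) {u v : V} (q w : G.Walk u v) (hq : q.IsPath) :
    walkLength ℓ q ≤ walkLength ℓ w := by
  have hqw : q = w.bypass := (hG.existsUnique_path u v).unique hq w.bypass_isPath
  have hsub : q.edges ⊆ w.edges := hqw ▸ w.edges_bypass_subset_edges
  obtain ⟨l, hl, hlw⟩ := List.subperm_of_subset hq.isTrail.edges_nodup hsub
  unfold walkLength
  rw [← (hl.map ℓ).sum_eq]
  refine (hlw.map ℓ).sum_le_sum fun a ha => ?_
  obtain ⟨e, he, rfl⟩ := List.mem_map.1 ha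
  exact (hℓ e (w.edges_subset_edgeSet he)).le

/-- The path from `r` to `x` in a tree. -/
noncomputable def rootPath (hG : G.IsTree) (r x : V) : G.Walk r x :=
  (hG.existsUnique_path r x).choose

lemma rootPath_isPath (hG : G.IsTree) (r x : V) : (rootPath hG r x).IsPath :=
  (hG.existsUnique_path r x).choose_spec.1

lemma eq_rootPath (hG : G.IsTree) {r x : V} {q : G.Walk r x} (hq : q.IsPath) :
    q = rootPath hG r x :=
  (hG.existsUnique_path r x).choose_spec.2 q hq

lemma length_rootPath_lt (hG : G.IsTree) {r x y : V} (h : x ∈ (rootPath hG r y).support)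
    (hxy : x ≠ y) : (rootPath hG r x).length < (rootPath hG r y).length := by
  classical
  rw [← eq_rootPath hG ((rootPath_isPath hG r y).takeUntil h)]
  exact SimpleGraph.Walk.length_takeUntil_lt_length h hxy

variable {E : Type*} [NormedAddCommGroup E] [InnerProductSpace ℝ E]

/-- The sum of `√(ℓ e) • u e` over the edges `e` of the path from `r` to `x`. -/
noncomputable def treeMap (hG : G.IsTree) (r : V) (ℓ : Sym2 V → ℝ) (u : Sym2 V → E) (x : V) : E :=
  ((rootPath hG r x).edges.map fun e => √(ℓ e) • u e).sum

lemma treeMap_sub_of_notMem (hG : G.IsTree) (r : V) (ℓ : Sym2 V → ℝ) (u : Sym2 V → E) {x y : V}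
    (h : G.Adj x y) (hy : y ∉ (rootPath hG r x).support) :
    treeMap hG r ℓ u y - treeMap hG r ℓ u x = √(ℓ s(x, y)) • u s(x, y) := by
  unfold treeMap
  rw [← eq_rootPath hG ((rootPath_isPath hG r x).concat hy h), SimpleGraph.Walk.edges_concat]
  simp

/-- The sign `ε` records whether the edge leads away from the root or towards it. -/
lemma treeMap_sub_of_adj (hG : G.IsTree) (r : V) (ℓ : Sym2 V → ℝ) (u : Sym2 V → E) {x y : V}
    (h : G.Adj x y) : ∃ ε : ℝ, ε ^ 2 = 1 ∧
      treeMap hG r ℓ u y - treeMap hG r ℓ u x = ε • √(ℓ s(x, y)) • u s(x, y) := by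
  by_cases hy : y ∈ (rootPath hG r x).support
  · refine ⟨-1, by norm_num, ?_⟩
    have hx : x ∉ (rootPath hG r y).support := fun hx =>
      (length_rootPath_lt hG hx h.ne).not_gt (length_rootPath_lt hG hy h.ne')
    rw [← neg_sub, treeMap_sub_of_notMem hG r ℓ u h.symm hx, Sym2.eq_swap]
    simp
  · exact ⟨1, by norm_num, by rw [treeMap_sub_of_notMem hG r ℓ u h hy, one_smul]⟩

/-- The difference telescopes along `q` into multiples of the vectors of the edges crossed. -/
lemma inner_treeMap_sub_eq_zero (hG : G.IsTree) (r : V) (ℓ : Sym2 V → ℝ) {u : Sym2 V → E}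
    (hu : Orthonormal ℝ u) {x y : V} (q : G.Walk x y) {e : Sym2 V} (he : e ∉ q.edges) :
    ⟪u e, treeMap hG r ℓ u y - treeMap hG r ℓ u x⟫ = 0 := by
  induction q with
  | nil => simp
  | cons h q ih =>
    rw [SimpleGraph.Walk.edges_cons, List.mem_cons, not_or] at he
    obtain ⟨ε, -, hε⟩ := treeMap_sub_of_adj hG r ℓ u h
    rw [← sub_add_sub_cancel, inner_add_right, ih he.2, hε, inner_smul_right, inner_smul_right,
      hu.2 he.1]
    simp

/-- Pythagoras: a path repeats no edge, so its steps are mutually orthogonal. -/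
lemma norm_treeMap_sub_sq (hG : G.IsTree) (r : V) {ℓ : Sym2 V → ℝ}
    (hℓ : ∀ e ∈ G.edgeSet, 0 < ℓ e) {u : Sym2 V → E} (hu : Orthonormal ℝ u) {x y : V}
    (q : G.Walk x y) (hq : q.IsPath) :
    ‖treeMap hG r ℓ u y - treeMap hG r ℓ u x‖ ^ 2 = walkLength ℓ q := by
  induction q with
  | nil => simp [walkLength]
  | @cons a b c h q ih =>
    have hnd := hq.isTrail.edges_nodup
    rw [SimpleGraph.Walk.edges_cons, List.nodup_cons] at hnd
    obtain ⟨ε, hε1, hε⟩ := treeMap_sub_of_adj hG r ℓ u h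
    have h0 := inner_treeMap_sub_eq_zero hG r ℓ hu q hnd.1
    rw [← sub_add_sub_cancel, norm_add_sq_real, ih hq.of_cons, hε, inner_smul_right,
      inner_smul_right, real_inner_comm, h0, norm_smul, norm_smul, hu.1, mul_pow, mul_pow,
      Real.norm_eq_abs, Real.norm_eq_abs, sq_abs, sq_abs, hε1, Real.sq_sqrt (hℓ _ h).le]
    simp only [walkLength, SimpleGraph.Walk.edges_cons, List.map_cons, List.sum_cons]
    ring

lemma inner_treeMap (hG : G.IsTree) (r : V) (ℓ : Sym2 V → ℝ) {u : Sym2 V → E}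
    (hu : Orthonormal ℝ u) [DecidableEq V] (e : Sym2 V) (x : V) :
    ⟪u e, treeMap hG r ℓ u x⟫ = if e ∈ (rootPath hG r x).edges then √(ℓ e) else 0 := by
  have key : ∀ L : List (Sym2 V), L.Nodup →
      ⟪u e, (L.map fun e => √(ℓ e) • u e).sum⟫ = if e ∈ L then √(ℓ e) else 0 := by
    intro L hL
    induction L with
    | nil => simp
    | cons a L ih =>
      rw [List.nodup_cons] at hL
      rw [List.map_cons, List.sum_cons, inner_add_right, ih hL.2, inner_smul_right,
        orthonormal_iff_ite.1 hu]
      by_cases h : e = a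
      · subst h; simp [hL.1]
      · simp [h]
  exact key _ (rootPath_isPath hG r x).isTrail.edges_nodup

/-- Among the vertices of nonzero weight take `x` farthest from the root, counted in edges. The last
edge into `x` is used only by root paths through `x`, and the other vertices with such paths are
farther away, hence of weight zero. Pairing the relation with that edge vector kills `w x`. If `x =
r` there is no last edge, and the vanishing weight sum is used instead. -/
lemma affineIndependent_treeMap (hG : G.IsTree) (r : V) {ℓ : Sym2 V → ℝ}
    (hℓ : ∀ e ∈ G.edgeSet, 0 < ℓ e) {u : Sym2 V → E} (hu : Orthonormal ℝ u) :
    AffineIndependent ℝ (treeMap hG r ℓ u) := by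
  classical
  rw [affineIndependent_iff]
  intro s w hw0 hw1
  by_contra! hne
  have hS : (s.filter fun x => w x ≠ 0).Nonempty := by
    obtain ⟨x, hx, hwx⟩ := hne
    exact ⟨x, Finset.mem_filter.2 ⟨hx, hwx⟩⟩
  obtain ⟨x, hx, hmax⟩ := Finset.exists_max_image _ (fun x => (rootPath hG r x).length) hS
  obtain ⟨hxs, hwx⟩ := Finset.mem_filter.1 hx
  have hzero : ∀ y ∈ s, y ≠ x → x ∈ (rootPath hG r y).support → w y = 0 := by
    intro y hy hyx hmem
    by_contra hwy
    exact (hmax y (Finset.mem_filter.2 ⟨hy, hwy⟩)).not_gt (length_rootPath_lt hG hmem hyx.symm)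
  by_cases hxr : x = r
  · refine hwx ?_
    rw [← hw0, Finset.sum_eq_single_of_mem x hxs]
    exact fun y hy hyx => hzero y hy hyx (hxr ▸ SimpleGraph.Walk.start_mem_support _)
  · have hadj := (rootPath hG r x).adj_penultimate (SimpleGraph.Walk.not_nil_of_ne (Ne.symm hxr))
    have hmem : s((rootPath hG r x).penultimate, x) ∈ (rootPath hG r x).edges :=
      SimpleGraph.Walk.mk_penultimate_end_mem_edges (SimpleGraph.Walk.not_nil_of_ne (Ne.symm hxr))
    have h := congrArg (fun v => ⟪u s((rootPath hG r x).penultimate, x), v⟫) hw1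
    simp only [inner_sum, inner_smul_right, inner_treeMap hG r ℓ hu, inner_zero_right] at h
    rw [Finset.sum_eq_single_of_mem x hxs, if_pos hmem] at h
    · exact (mul_ne_zero hwx (Real.sqrt_pos.2 (hℓ _ hadj)).ne') h
    · intro y hy hyx
      split_ifs with hmem'
      · rw [hzero y hy hyx (SimpleGraph.Walk.snd_mem_support_of_mem_edges _ hmem'), zero_mul]
      · rw [mul_zero]

/-- If every path of a tree has length at most one, then the tree has at most two vertices. -/
lemma eq_of_no_two_path (hG : G.IsTree)
    (h : ∀ x y z : V, G.Adj x y → G.Adj y z → x = z) {r x y : V} (hx : x ≠ r) (hy : y ≠ r) :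
    x = y := by
  have key : ∀ z, z ≠ r → G.Adj r z := by
    intro z hz
    have hp := rootPath_isPath hG r z
    cases hq : rootPath hG r z with
    | nil => exact absurd rfl hz
    | cons h1 q =>
      rw [hq] at hp
      cases q with
      | nil => exact h1
      | cons h2 q =>
        have := h _ _ _ h1 h2
        subst this
        simp at hp
  exact h _ _ _ (key x hx).symm (key y hy)

end Graph

/-! ### Metric trees and exponents above one. -/

lemma dist_eq_walkLength_of_isPath {T : Type*} [MetricSpace T] {G : SimpleGraph T}
    {ℓ : Sym2 T → ℝ} (hG : G.IsTree) (hℓ : ∀ e ∈ G.edgeSet, 0 < ℓ e)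
    (hd : ∀ u v : T, IsLeast (Set.range fun q : G.Walk u v => walkLength ℓ q) (dist u v))
    {x y : T} (q : G.Walk x y) (hq : q.IsPath) : dist x y = walkLength ℓ q := by
  classical
  obtain ⟨⟨w, hw⟩, hle⟩ := hd x y
  exact le_antisymm (hle ⟨q, rfl⟩) (hw ▸ walkLength_le_of_isPath hG hℓ q w hq)

/-- The canonical embedding of `(T, √d)` for a metric tree `T`. -/
lemma IsMetricTree.exists_affineIndependent_embedding {T : Type*} [MetricSpace T]
    (hT : IsMetricTree T) :
    ∃ f : T → EllTwo, AffineIndependent ℝ f ∧ ∀ x y, dist (f x) (f y) = √(dist x y) := by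
  obtain ⟨G, ℓ, hG, hfin, hℓ, hd⟩ := hT
  have : Countable T := countable_of_locallyFinite hG.connected hfin
  obtain ⟨r⟩ := hG.connected.nonempty
  have : Countable (Sym2 T) := by unfold Sym2; infer_instance
  obtain ⟨g, hg⟩ := exists_injective_nat (Sym2 T)
  let c : HilbertBasis ℕ ℝ EllTwo := HilbertBasis.ofRepr (LinearIsometryEquiv.refl ℝ EllTwo)
  have hu : Orthonormal ℝ (fun e => c (g e)) := c.orthonormal.comp g hg
  refine ⟨treeMap hG r ℓ _, affineIndependent_treeMap hG r hℓ hu, fun x y => ?_⟩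
  obtain ⟨q, hq, -⟩ := hG.existsUnique_path x y
  rw [dist_eq_walkLength_of_isPath hG hℓ hd q hq, ← norm_treeMap_sub_sq hG r hℓ hu q hq,
    Real.sqrt_sq (norm_nonneg _), dist_comm, dist_eq_norm]

lemma IsMetricTree.countable {T : Type*} [MetricSpace T] (hT : IsMetricTree T) : Countable T := by
  obtain ⟨G, -, hG, hfin, -⟩ := hT
  exact countable_of_locallyFinite hG.connected hfin

lemma IsMetricTree.nonempty {T : Type*} [MetricSpace T] (hT : IsMetricTree T) : Nonempty T := by
  obtain ⟨G, -, hG, -⟩ := hT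
  exact hG.connected.nonempty

/-- If `d ^ (p / 2)` is Hilbertian with `p > 2`, then no point lies metrically between two others. -/
lemma IsPowerEmbedding.dist_ne_add {X : Type*} [MetricSpace X] {p : ℝ} (hp : 2 < p)
    {f : X → EllTwo} (hf : IsPowerEmbedding p f) {x y z : X} (hxy : x ≠ y) (hyz : y ≠ z) :
    dist x z ≠ dist x y + dist y z := by
  intro h
  have hs : 0 < dist x y := dist_pos.2 hxy
  have ht : 0 < dist y z := dist_pos.2 hyz
  have htri := dist_triangle (f x) (f y) (f z)
  -- This form shows that `a ^ (p / 2)` is strictly superadditive for `p > 2`, against the triangle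
  -- inequality in `ℓ₂`.
  have hsqrt : ∀ a : ℝ, 0 < a → √(a ^ p) = a * a ^ (p / 2 - 1) := fun a ha => by
    rw [Real.sqrt_eq_rpow, ← Real.rpow_mul ha.le]
    nth_rewrite 2 [← Real.rpow_one a]
    rw [← Real.rpow_add ha]
    congr 1
    ring
  rw [hf, hf, hf, h, hsqrt _ hs, hsqrt _ ht, hsqrt _ (add_pos hs ht), add_mul] at htri
  have hq : 0 < p / 2 - 1 := by linarith
  have h1 := Real.rpow_lt_rpow hs.le (lt_add_of_pos_right _ ht) hq
  have h2 := Real.rpow_lt_rpow ht.le (lt_add_of_pos_left _ hs) hq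
  have h3 := mul_lt_mul_of_pos_left h1 hs
  have h4 := mul_lt_mul_of_pos_left h2 ht
  linarith

/-- A metric tree without metric betweenness embeds isometrically in `ℓ₂`. -/
lemma IsMetricTree.exists_isPowerEmbedding_two {T : Type*} [MetricSpace T] (hT : IsMetricTree T)
    (h : ∀ x y z : T, x ≠ y → y ≠ z → dist x z ≠ dist x y + dist y z) :
    ∃ f : T → EllTwo, IsPowerEmbedding 2 f := by
  obtain ⟨G, ℓ, hG, hfin, hℓ, hd⟩ := hT
  obtain ⟨r⟩ := hG.connected.nonempty
  -- The middle vertex of a path with two edges would lie metrically between its ends.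
  have htwo : ∀ x y z : T, G.Adj x y → G.Adj y z → x = z := by
    intro x y z hxy hyz
    by_contra hne
    refine h x y z hxy.ne hyz.ne ?_
    have e1 := dist_eq_walkLength_of_isPath hG hℓ hd (.cons hxy .nil)
      (by simp [hxy.ne])
    have e2 := dist_eq_walkLength_of_isPath hG hℓ hd (.cons hyz .nil)
      (by simp [hyz.ne])
    have e3 := dist_eq_walkLength_of_isPath hG hℓ hd (.cons hxy (.cons hyz .nil))
      (by simp [hxy.ne, hyz.ne, hne])
    rw [e1, e2, e3]
    simp [walkLength]
  have huniq : ∀ x y : T, x ≠ r → y ≠ r → x = y := fun x y => eq_of_no_two_path hG htwo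
  obtain ⟨v, hv⟩ : ∃ v : EllTwo, ‖v‖ = 1 := ⟨lp.single 2 0 1, by simp [lp.norm_single]⟩
  refine ⟨fun x => dist x r • v, fun x y => ?_⟩
  rw [dist_eq_norm, ← sub_smul, norm_smul, hv, mul_one, Real.norm_eq_abs, Real.rpow_two,
    Real.sqrt_sq dist_nonneg]
  by_cases hx : x = r
  · subst hx
    simp [dist_comm]
  by_cases hy : y = r
  · subst hy
    simp
  · simp [huniq x y hx hy]

/-- A roundness exponent greater than one of a metric tree yields an embedding of a power
transform `√(d ^ q)` with `1 < q ≤ 2`. -/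
lemma IsMetricTree.not_noPowerEmbedding {T : Type*} [MetricSpace T] (hT : IsMetricTree T) {p : ℝ≥0}
    (hp : 1 < p) (h : IsGeneralizedRoundnessExponent T p) : ¬ NoPowerEmbedding T := by
  intro hno
  have := hT.countable
  have := hT.nonempty
  have hp1 : (1 : ℝ) < p := by exact_mod_cast hp
  obtain ⟨f, hf⟩ := h.exists_isPowerEmbedding (zero_lt_one.trans hp).ne'
  obtain hp2 | hp2 := le_or_gt (p : ℝ) 2
  · exact hno p hp1 hp2 ⟨f, hf⟩
  · exact hno 2 one_lt_two le_rfl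
      (hT.exists_isPowerEmbedding_two fun x y z hxy hyz => hf.dist_ne_add hp2 hxy hyz)

end MetricTrees

theorem mainTheorem9 (T : Type*) [MetricSpace T] (hT : MetricTrees.IsMetricTree T) :
    (MetricTrees.generalizedRoundness T = 1 →
      MetricTrees.SqrtIsometricToAffinelyIndependent T ∧ MetricTrees.NoPowerEmbedding T) ∧
    (MetricTrees.NoPowerEmbedding T → MetricTrees.generalizedRoundness T = 1) := by
  obtain ⟨f, hf, hdist⟩ := hT.exists_affineIndependent_embedding
  refine ⟨fun h => ⟨⟨Set.range f, hf.range, Equiv.ofInjective f hf.injective, hdist⟩, ?_⟩,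
    fun h => le_antisymm ?_ ?_⟩
  · rintro p hp1 - ⟨g, hg⟩
    lift p to ℝ≥0 using by linarith
    have hp : 1 < p := by exact_mod_cast hp1
    have hle : (p : ℝ≥0∞) ≤ MetricTrees.generalizedRoundness T :=
      le_iSup₂_of_le p (hg.isGeneralizedRoundnessExponent (zero_lt_one.trans hp).ne') le_rfl
    rw [h] at hle
    exact hp.not_ge (by exact_mod_cast hle)
  · refine iSup₂_le fun p hp => ?_
    by_contra! hlt
    exact hT.not_noPowerEmbedding (by exact_mod_cast hlt) hp h
  · have h1 : MetricTrees.IsPowerEmbedding ((1 : ℝ≥0) : ℝ) f := fun x y => by simp [hdist]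
    exact le_iSup₂_of_le 1 (h1.isGeneralizedRoundnessExponent one_ne_zero) (by simp)
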